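/- Let $\mathbb{k}$ be a commutative unital ring, $A$ an associative unital $\mathbb{k}$-algebra, and $(\Omega_d^\bullet,\wedge,d)$ an exterior algebra over $A$, i.e. an $\mathbb{N}$-graded differential graded $\mathbb{k}$-algebra with $\Omega_d^0=A$ that is generated as an algebra by $A$ and $dA$. For a left $A$-module $E$ write $\Omega_d^mE=\Omega_d^m\otimes_AE$ and $J_d^1E=J_d^1A\otimes_AE$, where $J_d^1A=(A\otimes_{\mathbb{k}}A)/N_d$ and $N_d=\{\sum a_i\otimes b_i:\ \sum a_ib_i=0,\ \sum a_i\,db_i=0\}$, with its evident $A$-bimodule structure. Let $(\Omega_d^1\ltimes\Omega_d^2)E$ be $\Omega_d^1E\oplus\Omega_d^2E$ with the left $A$-action $\lambda(\alpha+\beta)=\lambda\alpha+(d\lambda\wedge\alpha+\lambda\beta)$, and let $$\widetilde{\mathfrak D}_E=(\widetilde{\mathfrak D}^{I}_E,\widetilde{\mathfrak D}^{II}_E):J_d^1J_d^1E\to(\Omega_d^1\ltimes\Omega_d^2)E,$$ $$\widetilde{\mathfrak D}^{I}_E([a\otimes b]\otimes_A[c\otimes c']\otimes_A e)=a\,d(bc)\,c'\otimes_A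 e,\qquad \widetilde{\mathfrak D}^{II}_E([a\otimes b]\otimes_A[c\otimes c']\otimes_A e)=da\wedge d(bc)\,c'\otimes_A e .$$ *Holonomic jets:* $J_d^0E=E$, $J_d^1E$ is as above, $l_d^{1,0}=\mathrm{id}$, and for $n\ge 2$ the module $J_d^nE$ is the kernel of $\widetilde{\mathfrak D}_{J_d^{n-2}E}\circ J_d^1(l_d^{1,n-2})$ on $J_d^1J_d^{n-1}E$, with inclusion $l_d^{1,n-1}:J_d^nE\hookrightarrow J_d^1J_d^{n-1}E$. *Sesquiholonomic jets:* $J_d^{\{0\}}E=E$, $J_d^{\{1\}}E=J_d^1E$, $l_d^{\{1\}}=\mathrm{id}$, and for $n\ge 2$ the module $J_d^{\{n\}}E$ is the kernel of $\widetilde{\mathfrak D}^{I}_{J_d^{n-2}E}\circ J_d^1(l_d^{1,n-2})$ on $J_d^1J_d^{n-1}E$, with inclusion $l_d^{\{n\}}:J_d^{\{n\}}E\hookrightarrow J_d^1J_d^{n-1}E$. Let $t_d^{\{n\}}:J_d^nE\hookrightarrow J_d^{\{n\}}E$ be the natural inclusion (the identity for $n=0,1$) and, for $n\ge 1$, $l_d^{\{1,n-1\}}=J_d^1(t_d^{\{n-1\}})\circ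 l_d^{\{n\}}:J_d^{\{n\}}E\to J_d^1J_d^{\{n-1\}}E$. *Spencer operators:* let $\mathcal S^{1,m}_{d,E}:\Omega_d^mJ_d^1E\to\Omega_d^{m+1}E$, $\omega\otimes_A[y\otimes z]\otimes_A e\mapsto d(\omega y)z\otimes_A e$, and for $n\ge 1$, $m\ge 0$ put $$\mathcal S_d^{n,m}=\mathcal S^{1,m}_{d,J_d^{n-1}}\circ\Omega_d^m(l_d^{1,n-1}),\qquad \mathcal S_d^{\{n,m\}}=\mathcal S^{1,m}_{d,J_d^{\{n-1\}}}\circ\Omega_d^m(l_d^{\{1,n-1\}}),\qquad \overline{\mathcal S}_d^{\{n,m\}}=\mathcal S^{1,m}_{d,J_d^{n-1}}\circ\Omega_d^m(l_d^{\{n\}}),$$ where for $m=0$ one identifies $\Omega_d^0\otimes_A M$ with $M$. **Lemma 3.21.** For every $n\ge 2$ (and at every left $A$-module $E$): 1. $\mathcal S_d^{n-1,1}\circ\overline{\mathcal S}_d^{\{n,0\}}=-\widetilde{\mathfrak D}^{II}_{J_d^{n-2}}\circ J_d^1(l_d^{1,n-2})\circ l_d^{\{n\}}$ as maps $J_d^{\{n\}}\to\Omega_d^2J_d^{n-2}$;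 2. $\ker\big(\mathcal S_d^{n-1,1}\circ\overline{\mathcal S}_d^{\{n,0\}}\big)=J_d^n$, as submodules of $J_d^{\{n\}}$, where $J_d^n$ is identified with its image under $t_d^{\{n\}}$; 3. $\ker\big(\mathcal S_d^{\{n-1,1\}}\circ\mathcal S_d^{\{n,0\}}\big)\supseteq J_d^n$, with equality if $\Omega_d^2$ is flat as a right $A$-module. -/

import Mathlib

open scoped TensorProduct

universe v u

namespace NCJet

section BalancedTensor

variable (k : Type v) (A : Type u) [CommRing k] [Ring A] [Algebra k A]
variable (M : Type u) [AddCommGroup M] [Module k M] [Module A M] [IsScalarTower k A M]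
  [Module Aᵐᵒᵖ M] [SMulCommClass A Aᵐᵒᵖ M]
variable (N : Type u) [AddCommGroup N] [Module k N] [Module A N]

/-- The relations `m a ⊗ n = m ⊗ a n` inside `M ⊗[k] N`, for an `A`-bimodule `M` and a left
`A`-module `N`: their `k`-span, which is stable under the left action of `A` on `M`. -/
def balancedRel : Submodule A (M ⊗[k] N) where
  toAddSubmonoid := (Submodule.span k {t : M ⊗[k] N | ∃ (m : M) (a : A) (n : N),
    t = (MulOpposite.op a • m) ⊗ₜ[k] n - m ⊗ₜ[k] (a • n)}).toAddSubmonoid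
  smul_mem' := by
    intro c x hx
    change c • x ∈ Submodule.span k _
    change x ∈ Submodule.span k _ at hx
    induction hx using Submodule.span_induction with
    | mem x h =>
      obtain ⟨m, a, n, rfl⟩ := h
      refine Submodule.subset_span ⟨c • m, a, n, ?_⟩
      rw [smul_sub, TensorProduct.smul_tmul', TensorProduct.smul_tmul', smul_comm]
    | zero => simp
    | add x y _ _ hx hy => rw [smul_add]; exact add_mem hx hy
    | smul r x _ hx => rw [smul_comm]; exact Submodule.smul_mem _ _ hx

/-- The tensor product `M ⊗_A N` of an `A`-bimodule `M` with a left `A`-module `N`, for a possibly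
noncommutative ring `A`, as a left `A`-module. -/
def BTensor : Type u := (M ⊗[k] N) ⧸ balancedRel k A M N

instance : AddCommGroup (BTensor k A M N) :=
  inferInstanceAs (AddCommGroup ((M ⊗[k] N) ⧸ balancedRel k A M N))
instance : Module A (BTensor k A M N) :=
  inferInstanceAs (Module A ((M ⊗[k] N) ⧸ balancedRel k A M N))
instance : Module k (BTensor k A M N) :=
  inferInstanceAs (Module k ((M ⊗[k] N) ⧸ balancedRel k A M N))
instance : IsScalarTower k A (BTensor k A M N) :=
  inferInstanceAs (IsScalarTower k A ((M ⊗[k] N) ⧸ balancedRel k A M N))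

variable {k A M N}

/-- The elementary tensor `m ⊗_A n`. -/
def bt (m : M) (n : N) : BTensor k A M N := (balancedRel k A M N).mkQ (m ⊗ₜ[k] n)

theorem bt_add_left (m m' : M) (n : N) :
    (bt (m + m') n : BTensor k A M N) = bt m n + bt m' n := by
  simp only [bt, TensorProduct.add_tmul, map_add]; rfl

theorem bt_add_right (m : M) (n n' : N) :
    (bt m (n + n') : BTensor k A M N) = bt m n + bt m n' := by
  simp only [bt, TensorProduct.tmul_add, map_add]; rfl

theorem bt_smul_left (a : A) (m : M) (n : N) :
    (bt (a • m) n : BTensor k A M N) = a • bt m n := by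
  unfold bt
  rw [← TensorProduct.smul_tmul', map_smul]; rfl

theorem bt_ksmul_left (c : k) (m : M) (n : N) :
    (bt (c • m) n : BTensor k A M N) = c • bt m n := rfl

theorem bt_ksmul_right (c : k) (m : M) (n : N) :
    (bt m (c • n) : BTensor k A M N) = c • bt m n := by
  rw [← bt_ksmul_left]; unfold bt; rw [TensorProduct.smul_tmul]

theorem bt_balanced (m : M) (a : A) (n : N) :
    (bt (MulOpposite.op a • m) n : BTensor k A M N) = bt m (a • n) := by
  refine (Submodule.Quotient.eq _).2 ?_
  exact Submodule.subset_span ⟨m, a, n, rfl⟩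

@[elab_as_elim]
theorem BTensor.induction {p : BTensor k A M N → Prop} (x : BTensor k A M N)
    (tmul : ∀ m n, p (bt m n)) (add : ∀ x y, p x → p y → p (x + y)) : p x := by
  obtain ⟨t, rfl⟩ := Submodule.Quotient.mk_surjective _ x
  induction t with
  | zero => have h := tmul 0 0; simpa [bt] using h
  | tmul m n => exact tmul m n
  | add s t hs ht => exact add _ _ hs ht

/-- The `k`-linear map out of `M ⊗_A N` induced by an `A`-balanced bilinear map. -/
def BTensor.lift {P : Type u} [AddCommGroup P] [Module k P] (f : M →ₗ[k] N →ₗ[k] P)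
    (hf : ∀ m (a : A) n, f (MulOpposite.op a • m) n = f m (a • n)) :
    BTensor k A M N →ₗ[k] P :=
  (((balancedRel k A M N).restrictScalars k).liftQ (TensorProduct.lift f) (by
      intro x hx
      change x ∈ Submodule.span k _ at hx
      induction hx using Submodule.span_induction with
      | mem x h => obtain ⟨m, a, n, rfl⟩ := h; simp [hf]
      | zero => simp
      | add x y _ _ hx hy => exact add_mem hx hy
      | smul r x _ hx => exact Submodule.smul_mem _ _ hx)) ∘ₗ
    (Submodule.Quotient.restrictScalarsEquiv k (balancedRel k A M N)).symm.toLinearMap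

theorem BTensor.lift_bt {P : Type u} [AddCommGroup P] [Module k P] (f : M →ₗ[k] N →ₗ[k] P)
    (hf : ∀ m (a : A) n, f (MulOpposite.op a • m) n = f m (a • n)) (m : M) (n : N) :
    BTensor.lift f hf (bt m n) = f m n := by
  rfl

/-- The `k`-linear map `g ⊗_A id_N : M ⊗_A N → M' ⊗_A N` induced by a right `A`-linear map `g`. -/
def BTensor.mapLeft (N : Type u) [AddCommGroup N] [Module k N] [Module A N]
    {M' : Type u} [AddCommGroup M'] [Module k M'] [Module A M']
    [IsScalarTower k A M'] [Module Aᵐᵒᵖ M'] [SMulCommClass A Aᵐᵒᵖ M']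
    (g : M →ₗ[k] M') (hg : ∀ (a : A) m, g (MulOpposite.op a • m) = MulOpposite.op a • g m) :
    BTensor k A M N →ₗ[k] BTensor k A M' N :=
  BTensor.lift
    (LinearMap.mk₂ k (fun m n => bt (g m) n)
      (fun m m' n => by rw [map_add, bt_add_left])
      (fun c m n => by rw [map_smul, bt_ksmul_left])
      (fun m n n' => by rw [bt_add_right])
      (fun c m n => by rw [bt_ksmul_right]))
    (fun m a n => by
      simp only [LinearMap.mk₂_apply]
      rw [hg, bt_balanced])

/-- The left `A`-linear map `id_M ⊗_A f : M ⊗_A N → M ⊗_A N'` induced by a left `A`-linear map `f`;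
this is the action on morphisms of the functor `M ⊗_A -`. -/
def BTensor.mapRight (M : Type u) [AddCommGroup M] [Module k M] [Module A M] [IsScalarTower k A M]
    [Module Aᵐᵒᵖ M] [SMulCommClass A Aᵐᵒᵖ M]
    {N N' : Type u} [AddCommGroup N] [Module k N] [Module A N] [IsScalarTower k A N]
    [AddCommGroup N'] [Module k N'] [Module A N'] [IsScalarTower k A N'] (f : N →ₗ[A] N') :
    BTensor k A M N →ₗ[A] BTensor k A M N' :=
  let F : BTensor k A M N →ₗ[k] BTensor k A M N' := BTensor.lift
    (LinearMap.mk₂ k (fun m n => bt m (f n))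
      (fun m m' n => by rw [bt_add_left])
      (fun c m n => by rw [bt_ksmul_left])
      (fun m n n' => by rw [map_add, bt_add_right])
      (fun c m n => by rw [← LinearMap.restrictScalars_apply k f, map_smul, bt_ksmul_right]; rfl))
    (fun m a n => by
      simp only [LinearMap.mk₂_apply]
      rw [bt_balanced, map_smul])
  { toFun := F
    map_add' := F.map_add
    map_smul' := by
      intro a x
      induction x using BTensor.induction with
      | tmul m n => rw [← bt_smul_left]; exact bt_smul_left a m (f n)
      | add x y hx hy => rw [smul_add, map_add, hx, hy, map_add, smul_add] }

theorem BTensor.mapLeft_bt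
    {M' : Type u} [AddCommGroup M'] [Module k M'] [Module A M']
    [IsScalarTower k A M'] [Module Aᵐᵒᵖ M'] [SMulCommClass A Aᵐᵒᵖ M']
    (g : M →ₗ[k] M') (hg : ∀ (a : A) m, g (MulOpposite.op a • m) = MulOpposite.op a • g m)
    (m : M) (n : N) : BTensor.mapLeft N g hg (bt m n) = bt (g m) n := rfl

theorem BTensor.mapRight_bt
    {N' : Type u} [AddCommGroup N'] [Module k N'] [Module A N'] [IsScalarTower k A N]
    [IsScalarTower k A N'] (f : N →ₗ[A] N') (m : M) (n : N) :
    BTensor.mapRight (k := k) M f (bt m n) = bt m (f n) := rfl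

/-- The `k`-linear map `X ⊗_A (Y ⊗_A N) → Z ⊗_A N`, `x ⊗ (y ⊗ n) ↦ g x y ⊗ n`, induced by an
`A`-balanced bilinear map `g` of bimodules which is right `A`-linear in its second argument. -/
def BTensor.lift₂ (N : Type u) [AddCommGroup N] [Module k N] [Module A N]
    {X Y Z : Type u}
    [AddCommGroup X] [Module k X] [Module A X] [IsScalarTower k A X] [Module Aᵐᵒᵖ X]
    [SMulCommClass A Aᵐᵒᵖ X]
    [AddCommGroup Y] [Module k Y] [Module A Y] [IsScalarTower k A Y] [Module Aᵐᵒᵖ Y]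
    [SMulCommClass A Aᵐᵒᵖ Y]
    [AddCommGroup Z] [Module k Z] [Module A Z] [IsScalarTower k A Z] [Module Aᵐᵒᵖ Z]
    [SMulCommClass A Aᵐᵒᵖ Z]
    (g : X →ₗ[k] Y →ₗ[k] Z)
    (hbal : ∀ x (a : A) y, g (MulOpposite.op a • x) y = g x (a • y))
    (hlin : ∀ x (a : A) y, g x (MulOpposite.op a • y) = MulOpposite.op a • g x y) :
    BTensor k A X (BTensor k A Y N) →ₗ[k] BTensor k A Z N :=
  BTensor.lift
    { toFun := fun x => BTensor.mapLeft N (g x) (hlin x)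
      map_add' := fun x x' => by
        ext t
        induction t using BTensor.induction with
        | tmul y n =>
          simp only [LinearMap.add_apply, BTensor.mapLeft_bt, map_add, bt_add_left]
        | add s t hs ht => rw [map_add, hs, ht, map_add]
      map_smul' := fun c x => by
        ext t
        induction t using BTensor.induction with
        | tmul y n =>
          simp only [LinearMap.smul_apply, BTensor.mapLeft_bt, map_smul, bt_ksmul_left,
            RingHom.id_apply]
        | add s t hs ht => rw [map_add, hs, ht, map_add] }
    (fun x a t => by
      change BTensor.mapLeft N (g (MulOpposite.op a • x)) (hlin _) t =
        BTensor.mapLeft N (g x) (hlin x) (a • t)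
      induction t using BTensor.induction with
      | tmul y n => rw [← bt_smul_left, BTensor.mapLeft_bt, BTensor.mapLeft_bt, hbal]
      | add s t hs ht => rw [map_add, hs, ht, smul_add, map_add])

end BalancedTensor

/-- A left `A`-module over the `k`-algebra `A`, bundled with its induced `k`-module structure. -/
structure LMod (k : Type v) (A : Type u) [CommRing k] [Ring A] [Algebra k A] where
  /-- the underlying type -/
  carrier : Type u
  [addCommGroup : AddCommGroup carrier]
  [moduleBase : Module k carrier]
  [module : Module A carrier]
  [isScalarTower : IsScalarTower k A carrier]

instance (k : Type v) (A : Type u) [CommRing k] [Ring A] [Algebra k A] :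
    CoeSort (LMod k A) (Type u) := ⟨LMod.carrier⟩

attribute [instance] LMod.addCommGroup LMod.moduleBase LMod.module LMod.isScalarTower

/-- A bimodule `M` is flat as a right `A`-module: `M ⊗_A -` preserves injectivity of
maps of left `A`-modules. -/
def IsRightFlat (k : Type v) (A : Type u) [CommRing k] [Ring A] [Algebra k A]
    (M : Type u) [AddCommGroup M] [Module k M] [Module A M] [IsScalarTower k A M]
    [Module Aᵐᵒᵖ M] [SMulCommClass A Aᵐᵒᵖ M] : Prop :=
  ∀ (N N' : LMod k A) (f : N →ₗ[A] N'), Function.Injective f →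
    Function.Injective (BTensor.mapRight (k := k) M f)

/-- An exterior algebra over the `k`-algebra `A`: a differential graded `k`-algebra
`Ω = ⨁ₙ Ωⁿ` with `Ω⁰ = A` which is generated, as an algebra, by `A` and `dA`. -/
structure ExteriorCalculus (k : Type v) (A : Type u) [CommRing k] [Ring A] [Algebra k A] where
  /-- the total algebra `Ω` -/
  carrier : Type u
  [ring : Ring carrier]
  [algebra : Algebra k carrier]
  /-- the homogeneous components `Ωⁿ` -/
  grade : ℕ → Submodule k carrier
  gradedMonoid : SetLike.GradedMonoid grade
  isInternal : DirectSum.IsInternal grade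
  /-- the identification of `A` with `Ω⁰` -/
  incl : A →ₐ[k] carrier
  incl_injective : Function.Injective incl
  range_incl : LinearMap.range incl.toLinearMap = grade 0
  /-- the exterior derivative -/
  d : carrier →ₗ[k] carrier
  d_mem : ∀ (n : ℕ) (x : carrier), x ∈ grade n → d x ∈ grade (n + 1)
  d_mul : ∀ (n : ℕ) (x y : carrier), x ∈ grade n → d (x * y) = d x * y + (-1) ^ n * (x * d y)
  d_d : ∀ x : carrier, d (d x) = 0
  adjoin_eq_top :
    Algebra.adjoin k (Set.range incl ∪ Set.range (fun a => d (incl a))) = ⊤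

attribute [instance] ExteriorCalculus.ring ExteriorCalculus.algebra

namespace ExteriorCalculus

variable {k : Type v} {A : Type u} [CommRing k] [Ring A] [Algebra k A] (Ω : ExteriorCalculus k A)

theorem incl_mem (a : A) : Ω.incl a ∈ Ω.grade 0 := by
  rw [← Ω.range_incl]; exact ⟨a, rfl⟩

theorem mul_mem {p q : ℕ} {x y : Ω.carrier} (hx : x ∈ Ω.grade p) (hy : y ∈ Ω.grade q) :
    x * y ∈ Ω.grade (p + q) := by
  have := Ω.gradedMonoid
  exact SetLike.mul_mem_graded hx hy

theorem incl_mul_mem {p : ℕ} (a : A) {x : Ω.carrier} (hx : x ∈ Ω.grade p) :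
    Ω.incl a * x ∈ Ω.grade p := by
  simpa using Ω.mul_mem (Ω.incl_mem a) hx

theorem mul_incl_mem {p : ℕ} (a : A) {x : Ω.carrier} (hx : x ∈ Ω.grade p) :
    x * Ω.incl a ∈ Ω.grade p := by
  simpa using Ω.mul_mem hx (Ω.incl_mem a)

/-- The `A`-bimodule `Ωᵐ` of `m`-forms. -/
def Form (m : ℕ) : Type u := Ω.grade m

instance (m : ℕ) : AddCommGroup (Ω.Form m) := inferInstanceAs (AddCommGroup (Ω.grade m))
instance (m : ℕ) : Module k (Ω.Form m) := inferInstanceAs (Module k (Ω.grade m))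

variable {Ω} in
/-- A form as an element of the total algebra. -/
def Form.val {m : ℕ} (x : Ω.Form m) : Ω.carrier := Subtype.val x

variable {Ω} in
theorem Form.val_mem {m : ℕ} (x : Ω.Form m) : x.val ∈ Ω.grade m := Subtype.property x

variable {Ω} in
theorem Form.ext {m : ℕ} {x y : Ω.Form m} (h : x.val = y.val) : x = y := Subtype.ext h

variable {Ω} in
theorem Form.val_add {m : ℕ} (x y : Ω.Form m) : (x + y).val = x.val + y.val := rfl

variable {Ω} in
theorem Form.val_zero {m : ℕ} : (0 : Ω.Form m).val = 0 := rfl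

variable {Ω} in
theorem Form.val_smul {m : ℕ} (c : k) (x : Ω.Form m) : (c • x).val = c • x.val := rfl

instance (m : ℕ) : Module A (Ω.Form m) where
  smul a x := ⟨Ω.incl a * x.val, Ω.incl_mul_mem a x.val_mem⟩
  one_smul x := Form.ext (by change Ω.incl 1 * x.val = x.val; simp)
  mul_smul a b x := Form.ext (by
    change Ω.incl (a * b) * x.val = Ω.incl a * (Ω.incl b * x.val); simp [mul_assoc])
  smul_zero a := Form.ext (by change Ω.incl a * 0 = 0; simp)
  smul_add a x y := Form.ext (by
    change Ω.incl a * (x.val + y.val) = Ω.incl a * x.val + Ω.incl a * y.val; rw [mul_add])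
  add_smul a b x := Form.ext (by
    change Ω.incl (a + b) * x.val = Ω.incl a * x.val + Ω.incl b * x.val
    rw [map_add, add_mul])
  zero_smul x := Form.ext (by change Ω.incl 0 * x.val = 0; simp)

instance (m : ℕ) : Module Aᵐᵒᵖ (Ω.Form m) where
  smul a x := ⟨x.val * Ω.incl a.unop, Ω.mul_incl_mem a.unop x.val_mem⟩
  one_smul x := Form.ext (by change x.val * Ω.incl 1 = x.val; simp)
  mul_smul a b x := Form.ext (by
    change x.val * Ω.incl (b.unop * a.unop) = x.val * Ω.incl b.unop * Ω.incl a.unop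
    simp [mul_assoc])
  smul_zero a := Form.ext (by change 0 * Ω.incl a.unop = 0; simp)
  smul_add a x y := Form.ext (by
    change (x.val + y.val) * Ω.incl a.unop = x.val * Ω.incl a.unop + y.val * Ω.incl a.unop
    rw [add_mul])
  add_smul a b x := Form.ext (by
    change x.val * Ω.incl (a.unop + b.unop) = x.val * Ω.incl a.unop + x.val * Ω.incl b.unop
    rw [map_add, mul_add])
  zero_smul x := Form.ext (by change x.val * Ω.incl 0 = 0; simp)

variable {Ω} in
theorem Form.val_lsmul {m : ℕ} (a : A) (x : Ω.Form m) : (a • x).val = Ω.incl a * x.val := rfl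

variable {Ω} in
theorem Form.val_rsmul {m : ℕ} (a : A) (x : Ω.Form m) :
    (MulOpposite.op a • x).val = x.val * Ω.incl a := rfl

instance (m : ℕ) : SMulCommClass A Aᵐᵒᵖ (Ω.Form m) where
  smul_comm a b x := Form.ext (by
    change Ω.incl a * (x.val * Ω.incl b.unop) = Ω.incl a * x.val * Ω.incl b.unop
    rw [mul_assoc])

instance (m : ℕ) : IsScalarTower k A (Ω.Form m) where
  smul_assoc c a x := Form.ext (by
    change Ω.incl (c • a) * x.val = c • (Ω.incl a * x.val)
    rw [map_smul, smul_mul_assoc])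

/-- The wedge product `Ωᵖ × Ω^q → Ω^{p+q}`. -/
def wedge (p q : ℕ) : Ω.Form p →ₗ[k] Ω.Form q →ₗ[k] Ω.Form (p + q) :=
  LinearMap.mk₂ k (fun x y => ⟨x.val * y.val, Ω.mul_mem x.val_mem y.val_mem⟩)
    (fun x x' y => Form.ext (add_mul x.val x'.val y.val))
    (fun c x y => Form.ext (smul_mul_assoc c x.val y.val))
    (fun x y y' => Form.ext (mul_add x.val y.val y'.val))
    (fun c x y => Form.ext (mul_smul_comm c x.val y.val))

theorem val_wedge (p q : ℕ) (x : Ω.Form p) (y : Ω.Form q) :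
    (Ω.wedge p q x y).val = x.val * y.val := rfl

/-- The exterior derivative `d : Ωᵐ → Ω^{m+1}`. -/
def dForm (m : ℕ) : Ω.Form m →ₗ[k] Ω.Form (m + 1) where
  toFun x := ⟨Ω.d x.val, Ω.d_mem m _ x.val_mem⟩
  map_add' x y := Form.ext (Ω.d.map_add x.val y.val)
  map_smul' c x := Form.ext (Ω.d.map_smul c x.val)

theorem val_dForm (m : ℕ) (x : Ω.Form m) : (Ω.dForm m x).val = Ω.d x.val := rfl

/-- The derivation `d : A → Ω¹`. -/
def dA : A →ₗ[k] Ω.Form 1 where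
  toFun a := ⟨Ω.d (Ω.incl a), by simpa using Ω.d_mem 0 _ (Ω.incl_mem a)⟩
  map_add' x y := Form.ext (by
    change Ω.d (Ω.incl (x + y)) = Ω.d (Ω.incl x) + Ω.d (Ω.incl y); simp)
  map_smul' c x := Form.ext (by
    change Ω.d (Ω.incl (c • x)) = c • Ω.d (Ω.incl x); simp)

theorem val_dA (a : A) : (Ω.dA a).val = Ω.d (Ω.incl a) := rfl

theorem d_incl_mul (a : A) (x : Ω.carrier) :
    Ω.d (Ω.incl a * x) = Ω.d (Ω.incl a) * x + Ω.incl a * Ω.d x := by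
  rw [Ω.d_mul 0 _ _ (Ω.incl_mem a)]; simp

section Jet1A

/-- The left `A`-linear map `A ⊗[k] A → A`, `a ⊗ b ↦ a b`. -/
def mulMap (k : Type v) (A : Type u) [CommRing k] [Ring A] [Algebra k A] : A ⊗[k] A →ₗ[A] A :=
  TensorProduct.AlgebraTensorModule.lift
    (LinearMap.toSpanSingleton A (A →ₗ[k] A) LinearMap.id)

/-- The left `A`-linear map `A ⊗[k] A → Ω¹`, `a ⊗ b ↦ a db`. -/
def adMap : A ⊗[k] A →ₗ[A] Ω.Form 1 :=
  TensorProduct.AlgebraTensorModule.lift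
    (LinearMap.toSpanSingleton A (A →ₗ[k] Ω.Form 1) Ω.dA)

theorem mulMap_tmul (a b : A) : mulMap k A (a ⊗ₜ[k] b) = a * b := rfl

theorem adMap_tmul (a b : A) : Ω.adMap (a ⊗ₜ[k] b) = a • Ω.dA b := rfl

/-- The submodule `N_d ⊆ A ⊗ A` of all `∑ aᵢ ⊗ bᵢ` with `∑ aᵢ bᵢ = 0` and `∑ aᵢ dbᵢ = 0`. -/
def Nd : Submodule A (A ⊗[k] A) := LinearMap.ker (mulMap k A) ⊓ LinearMap.ker Ω.adMap

/-- The `A`-bimodule of `1`-jets `J¹A = (A ⊗ A) / N_d`. -/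
def Jet1A : Type u := (A ⊗[k] A) ⧸ Ω.Nd

instance : AddCommGroup Ω.Jet1A := inferInstanceAs (AddCommGroup ((A ⊗[k] A) ⧸ Ω.Nd))
instance : Module A Ω.Jet1A := inferInstanceAs (Module A ((A ⊗[k] A) ⧸ Ω.Nd))
instance : Module k Ω.Jet1A := inferInstanceAs (Module k ((A ⊗[k] A) ⧸ Ω.Nd))
instance : IsScalarTower k A Ω.Jet1A :=
  inferInstanceAs (IsScalarTower k A ((A ⊗[k] A) ⧸ Ω.Nd))

/-- The class `[a ⊗ b]` in `J¹A`. -/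
def jc (a b : A) : Ω.Jet1A := Ω.Nd.mkQ (a ⊗ₜ[k] b)

variable {Ω} in
@[elab_as_elim]
theorem Jet1A.induction {p : Ω.Jet1A → Prop} (x : Ω.Jet1A)
    (tmul : ∀ a b, p (Ω.jc a b)) (add : ∀ x y, p x → p y → p (x + y)) : p x := by
  obtain ⟨t, rfl⟩ := Submodule.Quotient.mk_surjective _ x
  induction t with
  | zero => have h := tmul 0 0; simpa [jc] using h
  | tmul m n => exact tmul m n
  | add s t hs ht => exact add _ _ hs ht

/-- Right multiplication `a ⊗ b ↦ a ⊗ b c` on `A ⊗[k] A`. -/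
def rmulAA (k : Type v) {A : Type u} [CommRing k] [Ring A] [Algebra k A] (c : A) :
    A ⊗[k] A →ₗ[A] A ⊗[k] A :=
  TensorProduct.AlgebraTensorModule.lTensor A A (LinearMap.mulRight k c)

theorem rmulAA_tmul (c a b : A) : rmulAA k c (a ⊗ₜ[k] b) = a ⊗ₜ[k] (b * c) := rfl

theorem adMap_rmulAA (c : A) (t : A ⊗[k] A) :
    Ω.adMap (rmulAA k c t) = MulOpposite.op c • Ω.adMap t + mulMap k A t • Ω.dA c := by
  induction t with
  | zero => simp
  | tmul a b =>
    rw [rmulAA_tmul, adMap_tmul, adMap_tmul, mulMap_tmul]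
    apply Form.ext
    simp only [Form.val_add, Form.val_lsmul, Form.val_rsmul, val_dA, map_mul, d_incl_mul]
    noncomm_ring
  | add s t hs ht => simp only [map_add, hs, ht, smul_add, add_smul]; abel

theorem mulMap_rmulAA (c : A) (t : A ⊗[k] A) :
    mulMap k A (rmulAA k c t) = mulMap k A t * c := by
  induction t with
  | zero => simp
  | tmul a b => rw [rmulAA_tmul, mulMap_tmul, mulMap_tmul, mul_assoc]
  | add s t hs ht => simp only [map_add, hs, ht, add_mul]

/-- The right action `[a ⊗ b] c = [a ⊗ b c]` of `c` on `J¹A`. -/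
def rmulJ (c : A) : Ω.Jet1A →ₗ[A] Ω.Jet1A :=
  Submodule.mapQ Ω.Nd Ω.Nd (rmulAA k c) (by
    intro t ht
    obtain ⟨h1, h2⟩ := ht
    have h1' : mulMap k A t = 0 := h1
    have h2' : Ω.adMap t = 0 := h2
    refine ⟨?_, ?_⟩
    · change mulMap k A (rmulAA k c t) = 0
      rw [mulMap_rmulAA, h1', zero_mul]
    · change Ω.adMap (rmulAA k c t) = 0
      rw [adMap_rmulAA, h1', h2', smul_zero, zero_smul, add_zero])

theorem rmulJ_jc (c a b : A) : Ω.rmulJ c (Ω.jc a b) = Ω.jc a (b * c) := rfl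

instance : Module Aᵐᵒᵖ Ω.Jet1A where
  smul c x := Ω.rmulJ c.unop x
  one_smul x := by
    change Ω.rmulJ 1 x = x
    induction x using Jet1A.induction with
    | tmul a b => rw [rmulJ_jc, mul_one]
    | add x y hx hy => rw [map_add, hx, hy]
  mul_smul c e x := by
    change Ω.rmulJ (e.unop * c.unop) x = Ω.rmulJ c.unop (Ω.rmulJ e.unop x)
    induction x using Jet1A.induction with
    | tmul a b => rw [rmulJ_jc, rmulJ_jc, rmulJ_jc, mul_assoc]
    | add x y hx hy => simp only [map_add, hx, hy]
  smul_zero c := map_zero (Ω.rmulJ c.unop)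
  smul_add c x y := map_add (Ω.rmulJ c.unop) x y
  add_smul c e x := by
    change Ω.rmulJ (c.unop + e.unop) x = Ω.rmulJ c.unop x + Ω.rmulJ e.unop x
    induction x using Jet1A.induction with
    | tmul a b =>
      rw [rmulJ_jc, rmulJ_jc, rmulJ_jc, mul_add]
      simp only [jc, TensorProduct.tmul_add, map_add]; rfl
    | add x y hx hy => simp only [map_add, hx, hy]; abel
  zero_smul x := by
    change Ω.rmulJ 0 x = 0
    induction x using Jet1A.induction with
    | tmul a b => rw [rmulJ_jc, mul_zero]; simp only [jc, TensorProduct.tmul_zero, map_zero]; rfl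
    | add x y hx hy => rw [map_add, hx, hy, add_zero]

theorem op_smul_jc (c a b : A) : MulOpposite.op c • Ω.jc a b = Ω.jc a (b * c) := rfl

theorem smul_jc (c a b : A) : c • Ω.jc a b = Ω.jc (c * a) b := rfl

instance : SMulCommClass A Aᵐᵒᵖ Ω.Jet1A where
  smul_comm a c x := ((Ω.rmulJ c.unop).map_smul a x).symm

variable {Ω} in
/-- A `k`-linear map out of `J¹A = (A ⊗ A) / N_d` induced by a map on `A ⊗ A` vanishing on `N_d`. -/
def Jet1A.lift {P : Type u} [AddCommGroup P] [Module k P] (f : A →ₗ[k] A →ₗ[k] P)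
    (hf : ∀ t : A ⊗[k] A, mulMap k A t = 0 → Ω.adMap t = 0 → TensorProduct.lift f t = 0) :
    Ω.Jet1A →ₗ[k] P :=
  ((Ω.Nd.restrictScalars k).liftQ (TensorProduct.lift f) (fun t ht => hf t ht.1 ht.2)) ∘ₗ
    (Submodule.Quotient.restrictScalarsEquiv k Ω.Nd).symm.toLinearMap

variable {Ω} in
theorem Jet1A.lift_jc {P : Type u} [AddCommGroup P] [Module k P] (f : A →ₗ[k] A →ₗ[k] P)
    (hf : ∀ t : A ⊗[k] A, mulMap k A t = 0 → Ω.adMap t = 0 → TensorProduct.lift f t = 0)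
    (a b : A) : Jet1A.lift f hf (Ω.jc a b) = f a b := rfl

end Jet1A

/-- The map `Ωᵐ × J¹A → Ω^{m+1}`, `(ω, [y ⊗ z]) ↦ d(ω y) z`. -/
def spencerA (m : ℕ) : Ω.Form m →ₗ[k] Ω.Jet1A →ₗ[k] Ω.Form (m + 1) :=
  let f (ω : Ω.Form m) : A →ₗ[k] A →ₗ[k] Ω.Form (m + 1) :=
    LinearMap.mk₂ k (fun y z => MulOpposite.op z • Ω.dForm m (MulOpposite.op y • ω))
      (fun y y' z => by rw [MulOpposite.op_add, add_smul, map_add, smul_add])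
      (fun c y z => Form.ext (by
        simp only [Form.val_rsmul, val_dForm, Form.val_smul, map_smul, mul_smul_comm,
          smul_mul_assoc]))
      (fun y z z' => by rw [MulOpposite.op_add, add_smul])
      (fun c y z => Form.ext (by
        simp only [Form.val_rsmul, Form.val_smul, map_smul, mul_smul_comm]))
  have hf (ω : Ω.Form m) (t : A ⊗[k] A) : (TensorProduct.lift (f ω) t).val =
      Ω.d ω.val * Ω.incl (mulMap k A t) +
        (-1) ^ m * (ω.val * (Ω.d (Ω.incl (mulMap k A t)) - (Ω.adMap t).val)) := by
    induction t with
    | zero => simp [Form.val_zero]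
    | tmul y z =>
      change Ω.d (ω.val * Ω.incl y) * Ω.incl z = _
      rw [mulMap_tmul, adMap_tmul, Form.val_lsmul, val_dA, map_mul Ω.incl, d_incl_mul,
        Ω.d_mul m _ _ ω.val_mem]
      noncomm_ring
    | add s t hs ht =>
      simp only [map_add, Form.val_add, hs, ht]
      noncomm_ring
  { toFun := fun ω => Jet1A.lift (f ω) (fun t h1 h2 => Form.ext (by
      rw [hf, h1, h2]; simp [Form.val_zero]))
    map_add' := fun ω ω' => by
      ext x
      induction x using Jet1A.induction with
      | tmul y z =>
        change MulOpposite.op z • Ω.dForm m (MulOpposite.op y • (ω + ω')) =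
          MulOpposite.op z • Ω.dForm m (MulOpposite.op y • ω) +
          MulOpposite.op z • Ω.dForm m (MulOpposite.op y • ω')
        rw [smul_add, map_add, smul_add]
      | add s t hs ht => rw [map_add, hs, ht, map_add]
    map_smul' := fun c ω => by
      ext x
      induction x using Jet1A.induction with
      | tmul y z =>
        change MulOpposite.op z • Ω.dForm m (MulOpposite.op y • (c • ω)) =
          c • (MulOpposite.op z • Ω.dForm m (MulOpposite.op y • ω))
        exact Form.ext (by
          simp only [Form.val_rsmul, val_dForm, Form.val_smul, map_smul, smul_mul_assoc])
      | add s t hs ht => rw [map_add, hs, ht, map_add] }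

theorem spencerA_jc (m : ℕ) (ω : Ω.Form m) (y z : A) :
    Ω.spencerA m ω (Ω.jc y z) = MulOpposite.op z • Ω.dForm m (MulOpposite.op y • ω) := rfl

/-- The map `J¹A → Ω¹`, `[c ⊗ c'] ↦ (dc) c'`. -/
def sigmaA : Ω.Jet1A →ₗ[k] Ω.Form 1 :=
  let f : A →ₗ[k] A →ₗ[k] Ω.Form 1 :=
    LinearMap.mk₂ k (fun c c' => MulOpposite.op c' • Ω.dA c)
      (fun y y' z => by rw [map_add, smul_add])
      (fun c y z => Form.ext (by
        simp only [Form.val_rsmul, Form.val_smul, map_smul, smul_mul_assoc]))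
      (fun y z z' => by rw [MulOpposite.op_add, add_smul])
      (fun c y z => Form.ext (by
        simp only [Form.val_rsmul, Form.val_smul, map_smul, mul_smul_comm]))
  have hf (t : A ⊗[k] A) : TensorProduct.lift f t = Ω.dA (mulMap k A t) - Ω.adMap t := by
    induction t with
    | zero => simp
    | tmul y z =>
      apply Form.ext
      change Ω.d (Ω.incl y) * Ω.incl z = Ω.d (Ω.incl (y * z)) - Ω.incl y * Ω.d (Ω.incl z)
      rw [map_mul, d_incl_mul]; noncomm_ring
    | add s t hs ht => simp only [map_add, hs, ht]; abel
  Jet1A.lift f (fun t h1 h2 => by rw [hf, h1, h2]; simp)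

theorem sigmaA_jc (c c' : A) : Ω.sigmaA (Ω.jc c c') = MulOpposite.op c' • Ω.dA c := rfl

/-- The map `J¹A × J¹A → Ω¹`, `([a ⊗ b], [c ⊗ c']) ↦ a d(b c) c'`. -/
def tildeDIA : Ω.Jet1A →ₗ[k] Ω.Jet1A →ₗ[k] Ω.Form 1 :=
  let f : A →ₗ[k] A →ₗ[k] (Ω.Jet1A →ₗ[k] Ω.Form 1) :=
    LinearMap.mk₂ k
      (fun a b => Algebra.lsmul k k (Ω.Form 1) a ∘ₗ Ω.sigmaA ∘ₗ Algebra.lsmul k k Ω.Jet1A b)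
      (fun a a' b => by rw [map_add]; exact LinearMap.add_comp _ _ _)
      (fun c a b => by rw [map_smul]; exact LinearMap.smul_comp _ _ _)
      (fun a b b' => by rw [map_add, LinearMap.comp_add, LinearMap.comp_add])
      (fun c a b => by rw [map_smul, LinearMap.comp_smul, LinearMap.comp_smul])
  have hf (t : A ⊗[k] A) (c c' : A) : TensorProduct.lift f t (Ω.jc c c') =
      MulOpposite.op (c * c') • Ω.adMap t + mulMap k A t • MulOpposite.op c' • Ω.dA c := by
    induction t with
    | zero => simp
    | tmul a b =>
      apply Form.ext
      change Ω.incl a * (Ω.d (Ω.incl (b * c)) * Ω.incl c') =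
        (Ω.incl a * Ω.d (Ω.incl b)) * Ω.incl (c * c') +
          Ω.incl (a * b) * (Ω.d (Ω.incl c) * Ω.incl c')
      rw [map_mul Ω.incl, map_mul Ω.incl, map_mul Ω.incl, d_incl_mul]; noncomm_ring
    | add s t hs ht =>
      simp only [map_add, LinearMap.add_apply, hs, ht, smul_add, add_smul]; abel
  Jet1A.lift f (fun t h1 h2 => by
    ext y
    induction y using Jet1A.induction with
    | tmul c c' => rw [hf, h1, h2]; simp
    | add s t hs ht => rw [map_add, hs, ht, map_add])

theorem tildeDIA_jc (a b c c' : A) : Ω.tildeDIA (Ω.jc a b) (Ω.jc c c') =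
    a • MulOpposite.op c' • Ω.dA (b * c) := rfl

/-- The map `J¹A × J¹A → Ω²`, `([a ⊗ b], [c ⊗ c']) ↦ da ∧ d(b c) c'`. -/
def tildeDIIA : Ω.Jet1A →ₗ[k] Ω.Jet1A →ₗ[k] Ω.Form 2 :=
  let f : A →ₗ[k] A →ₗ[k] (Ω.Jet1A →ₗ[k] Ω.Form 2) :=
    LinearMap.mk₂ k
      (fun a b => Ω.wedge 1 1 (Ω.dA a) ∘ₗ Ω.sigmaA ∘ₗ Algebra.lsmul k k Ω.Jet1A b)
      (fun a a' b => by rw [map_add, map_add]; exact LinearMap.add_comp _ _ _)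
      (fun c a b => by rw [map_smul, map_smul]; exact LinearMap.smul_comp _ _ _)
      (fun a b b' => by rw [map_add, LinearMap.comp_add, LinearMap.comp_add])
      (fun c a b => by rw [map_smul, LinearMap.comp_smul, LinearMap.comp_smul])
  have hf (t : A ⊗[k] A) (c c' : A) : (TensorProduct.lift f t (Ω.jc c c')).val =
      Ω.d (Ω.adMap t).val * Ω.incl (c * c') +
        (Ω.d (Ω.incl (mulMap k A t)) - (Ω.adMap t).val) * (Ω.d (Ω.incl c) * Ω.incl c') := by
    induction t with
    | zero => simp [Form.val_zero]
    | tmul a b =>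
      change Ω.d (Ω.incl a) * (Ω.d (Ω.incl (b * c)) * Ω.incl c') =
        Ω.d (Ω.incl a * Ω.d (Ω.incl b)) * Ω.incl (c * c') +
        (Ω.d (Ω.incl (a * b)) - Ω.incl a * Ω.d (Ω.incl b)) * (Ω.d (Ω.incl c) * Ω.incl c')
      rw [map_mul Ω.incl, map_mul Ω.incl, map_mul Ω.incl, d_incl_mul, d_incl_mul, d_incl_mul, Ω.d_d]; noncomm_ring
    | add s t hs ht =>
      simp only [map_add, LinearMap.add_apply, hs, ht, Form.val_add]; noncomm_ring
  Jet1A.lift f (fun t h1 h2 => by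
    ext y
    induction y using Jet1A.induction with
    | tmul c c' => exact Form.ext (by rw [hf, h1, h2]; simp [Form.val_zero])
    | add s t hs ht => rw [map_add, hs, ht, map_add])

theorem tildeDIIA_jc (a b c c' : A) : Ω.tildeDIIA (Ω.jc a b) (Ω.jc c c') =
    Ω.wedge 1 1 (Ω.dA a) (MulOpposite.op c' • Ω.dA (b * c)) := rfl

/-- The left `A`-module `ΩᵐE = Ωᵐ ⊗_A E` of `m`-forms with values in `E`. -/
abbrev FormMod (m : ℕ) (E : LMod k A) : LMod k A where
  carrier := BTensor k A (Ω.Form m) E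

/-- The action `Ωᵐ(f)` of the functor `Ωᵐ ⊗_A -` on morphisms. -/
abbrev formMap (m : ℕ) {E E' : LMod k A} (f : E →ₗ[A] E') :
    Ω.FormMod m E →ₗ[A] Ω.FormMod m E' :=
  BTensor.mapRight (k := k) (Ω.Form m) f

/-- The left `A`-module of `1`-jets `J¹E = J¹A ⊗_A E`. -/
abbrev Jet1 (E : LMod k A) : LMod k A where
  carrier := BTensor k A Ω.Jet1A E

/-- The action `J¹(f)` of the functor `J¹ = J¹A ⊗_A -` on morphisms. -/
abbrev jet1Map {E E' : LMod k A} (f : E →ₗ[A] E') : Ω.Jet1 E →ₗ[A] Ω.Jet1 E' :=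
  BTensor.mapRight (k := k) Ω.Jet1A f

/-- The first order Spencer operator `S^{1,m}_E : Ωᵐ J¹E → Ω^{m+1} E`,
`ω ⊗ [y ⊗ z] ⊗ e ↦ d(ω y) z ⊗ e`. -/
def spencer1 (m : ℕ) (E : LMod k A) : Ω.FormMod m (Ω.Jet1 E) →ₗ[k] Ω.FormMod (m + 1) E :=
  BTensor.lift₂ E (Ω.spencerA m)
    (fun ω a x => by
      induction x using Jet1A.induction with
      | tmul y z => rw [smul_jc, spencerA_jc, spencerA_jc, MulOpposite.op_mul, mul_smul]
      | add s t hs ht => rw [map_add, hs, ht, smul_add, map_add])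
    (fun ω a x => by
      induction x using Jet1A.induction with
      | tmul y z => rw [op_smul_jc, spencerA_jc, spencerA_jc, MulOpposite.op_mul, mul_smul]
      | add s t hs ht => rw [map_add, smul_add, map_add, hs, ht, smul_add])

theorem spencer1_bt (m : ℕ) (E : LMod k A) (ω : Ω.Form m) (y z : A) (e : E) :
    Ω.spencer1 m E (bt ω (bt (Ω.jc y z) e)) =
      bt (MulOpposite.op z • Ω.dForm m (MulOpposite.op y • ω)) e := rfl

/-- The left `A`-linear map `D̃ᴵ_E : J¹J¹E → Ω¹E`,
`[a ⊗ b] ⊗ [c ⊗ c'] ⊗ e ↦ a d(b c) c' ⊗ e`. -/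
def tildeDI (E : LMod k A) : Ω.Jet1 (Ω.Jet1 E) →ₗ[A] Ω.FormMod 1 E :=
  let F : BTensor k A Ω.Jet1A (BTensor k A Ω.Jet1A E) →ₗ[k] BTensor k A (Ω.Form 1) E :=
    BTensor.lift₂ E Ω.tildeDIA
      (fun x r y => by
        induction x using Jet1A.induction with
        | tmul a b =>
          induction y using Jet1A.induction with
          | tmul c c' => rw [op_smul_jc, smul_jc, tildeDIA_jc, tildeDIA_jc, mul_assoc]
          | add s t hs ht => rw [map_add, hs, ht, smul_add, map_add]
        | add s t hs ht => simp only [smul_add, map_add, LinearMap.add_apply, hs, ht])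
      (fun x r y => by
        induction x using Jet1A.induction with
        | tmul a b =>
          induction y using Jet1A.induction with
          | tmul c c' =>
            rw [op_smul_jc, tildeDIA_jc, tildeDIA_jc, MulOpposite.op_mul, mul_smul, smul_comm]
          | add s t hs ht => rw [smul_add, map_add, hs, ht, map_add, smul_add]
        | add s t hs ht => simp only [smul_add, map_add, LinearMap.add_apply, hs, ht])
  { toFun := F
    map_add' := F.map_add
    map_smul' := fun r t => by
      induction t using BTensor.induction with
      | tmul x t =>
        induction t using BTensor.induction with
        | tmul y e =>
          induction x using Jet1A.induction with
          | tmul a b =>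
            induction y using Jet1A.induction with
            | tmul c c' =>
              rw [← bt_smul_left, smul_jc]
              change bt ((r * a) • MulOpposite.op c' • Ω.dA (b * c)) e =
                r • bt (a • MulOpposite.op c' • Ω.dA (b * c)) e
              rw [mul_smul, bt_smul_left]
            | add s t hs ht =>
              simp only [bt_add_left, bt_add_right, smul_add, map_add, hs, ht]
          | add s t hs ht => simp only [bt_add_left, smul_add, map_add, hs, ht]
        | add s t hs ht => simp only [bt_add_right, smul_add, map_add, hs, ht]
      | add s t hs ht => simp only [smul_add, map_add, hs, ht] }

theorem tildeDI_bt (E : LMod k A) (a b c c' : A) (e : E) :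
    Ω.tildeDI E (bt (Ω.jc a b) (bt (Ω.jc c c') e)) =
      bt (a • MulOpposite.op c' • Ω.dA (b * c)) e := rfl

/-- The `k`-linear map `D̃ᴵᴵ_E : J¹J¹E → Ω²E`,
`[a ⊗ b] ⊗ [c ⊗ c'] ⊗ e ↦ da ∧ d(b c) c' ⊗ e`. -/
def tildeDII (E : LMod k A) : Ω.Jet1 (Ω.Jet1 E) →ₗ[k] Ω.FormMod 2 E :=
  BTensor.lift₂ E Ω.tildeDIIA
    (fun x r y => by
      induction x using Jet1A.induction with
      | tmul a b =>
        induction y using Jet1A.induction with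
        | tmul c c' => rw [op_smul_jc, smul_jc, tildeDIIA_jc, tildeDIIA_jc, mul_assoc]
        | add s t hs ht => rw [map_add, hs, ht, smul_add, map_add]
      | add s t hs ht => simp only [smul_add, map_add, LinearMap.add_apply, hs, ht])
    (fun x r y => by
      induction x using Jet1A.induction with
      | tmul a b =>
        induction y using Jet1A.induction with
        | tmul c c' =>
          rw [op_smul_jc, tildeDIIA_jc, tildeDIIA_jc, MulOpposite.op_mul, mul_smul]
          exact Form.ext (mul_assoc _ _ _).symm
        | add s t hs ht => rw [smul_add, map_add, hs, ht, map_add, smul_add]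
      | add s t hs ht => simp only [smul_add, map_add, LinearMap.add_apply, hs, ht])

theorem tildeDII_bt (E : LMod k A) (a b c c' : A) (e : E) :
    Ω.tildeDII E (bt (Ω.jc a b) (bt (Ω.jc c c') e)) =
      bt (Ω.wedge 1 1 (Ω.dA a) (MulOpposite.op c' • Ω.dA (b * c)) : Ω.Form 2) e := rfl

/-- The map `α ↦ dr ∧ α`, `Ω¹E → Ω²E`, for `r ∈ A`. -/
def dWedge (E : LMod k A) (r : A) : Ω.FormMod 1 E →ₗ[k] Ω.FormMod 2 E :=
  BTensor.mapLeft E (M' := Ω.Form 2) (Ω.wedge 1 1 (Ω.dA r))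
    (fun _ _ => Form.ext (mul_assoc _ _ _).symm)

theorem dWedge_bt (E : LMod k A) (r : A) (ω : Ω.Form 1) (e : E) :
    Ω.dWedge E r (bt ω e) = bt (Ω.wedge 1 1 (Ω.dA r) ω : Ω.Form 2) e := rfl

theorem dWedge_one (E : LMod k A) (x : Ω.FormMod 1 E) : Ω.dWedge E 1 x = 0 := by
  induction x using BTensor.induction with
  | tmul ω e =>
    have h : Ω.dA 1 = 0 := Form.ext (by
      have := Ω.d_incl_mul 1 1
      simp only [map_one, one_mul, mul_one] at this
      rw [val_dA, map_one, Form.val_zero]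
      simpa using this)
    rw [dWedge_bt, h, map_zero, LinearMap.zero_apply]
    have := bt_ksmul_left (A := A) (0 : k) (0 : Ω.Form 2) e
    simpa using this
  | add x y hx hy => rw [map_add, hx, hy, add_zero]

theorem dWedge_mul (E : LMod k A) (r s : A) (x : Ω.FormMod 1 E) :
    Ω.dWedge E (r * s) x = Ω.dWedge E r (s • x) + r • Ω.dWedge E s x := by
  induction x using BTensor.induction with
  | tmul ω e =>
    rw [← bt_smul_left, dWedge_bt, dWedge_bt, dWedge_bt, ← bt_smul_left, ← bt_add_left]
    congr 1
    apply Form.ext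
    change Ω.d (Ω.incl (r * s)) * ω.val =
      Ω.d (Ω.incl r) * (Ω.incl s * ω.val) + Ω.incl r * (Ω.d (Ω.incl s) * ω.val)
    rw [map_mul Ω.incl, d_incl_mul]; noncomm_ring
  | add x y hx hy => simp only [map_add, smul_add, hx, hy]; abel

theorem dWedge_add (E : LMod k A) (r s : A) (x : Ω.FormMod 1 E) :
    Ω.dWedge E (r + s) x = Ω.dWedge E r x + Ω.dWedge E s x := by
  induction x using BTensor.induction with
  | tmul ω e =>
    rw [dWedge_bt, dWedge_bt, dWedge_bt, ← bt_add_left, map_add, map_add]; rfl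
  | add x y hx hy => simp only [map_add, hx, hy]; abel

/-- The `k`-module underlying `(Ω¹ ⋉ Ω²)E`, namely `Ω¹E ⊕ Ω²E`. -/
def SemiForm (E : LMod k A) : Type u := Ω.FormMod 1 E × Ω.FormMod 2 E

instance (E : LMod k A) : AddCommGroup (Ω.SemiForm E) :=
  inferInstanceAs (AddCommGroup (Ω.FormMod 1 E × Ω.FormMod 2 E))
instance (E : LMod k A) : Module k (Ω.SemiForm E) :=
  inferInstanceAs (Module k (Ω.FormMod 1 E × Ω.FormMod 2 E))

/-- The left `A`-action on `(Ω¹ ⋉ Ω²)E` is `r (α + β) = r α + (dr ∧ α + r β)`. -/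
instance (E : LMod k A) : Module A (Ω.SemiForm E) where
  smul r x := (r • x.1, Ω.dWedge E r x.1 + r • x.2)
  one_smul x := by
    change ((1 : A) • x.1, Ω.dWedge E 1 x.1 + (1 : A) • x.2) = x
    rw [dWedge_one, one_smul, one_smul, zero_add]; rfl
  mul_smul r s x := by
    change ((r * s) • x.1, Ω.dWedge E (r * s) x.1 + (r * s) • x.2) =
      (r • s • x.1, Ω.dWedge E r (s • x.1) + r • (Ω.dWedge E s x.1 + s • x.2))
    rw [dWedge_mul, mul_smul, mul_smul, smul_add, add_assoc]
  smul_zero r := by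
    change (r • (0 : Ω.FormMod 1 E), Ω.dWedge E r 0 + r • (0 : Ω.FormMod 2 E)) = (0, 0)
    rw [map_zero, smul_zero, smul_zero, add_zero]
  smul_add r x y := by
    change (r • (x.1 + y.1), Ω.dWedge E r (x.1 + y.1) + r • (x.2 + y.2)) =
      (r • x.1 + r • y.1, (Ω.dWedge E r x.1 + r • x.2) + (Ω.dWedge E r y.1 + r • y.2))
    rw [map_add, smul_add, smul_add, add_add_add_comm]
  add_smul r s x := by
    change ((r + s) • x.1, Ω.dWedge E (r + s) x.1 + (r + s) • x.2) =
      (r • x.1 + s • x.1, (Ω.dWedge E r x.1 + r • x.2) + (Ω.dWedge E s x.1 + s • x.2))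
    rw [dWedge_add, add_smul, add_smul, add_add_add_comm]
  zero_smul x := by
    change ((0 : A) • x.1, Ω.dWedge E 0 x.1 + (0 : A) • x.2) = (0, 0)
    have h : Ω.dWedge E 0 x.1 = 0 := by
      have h := Ω.dWedge_add E 0 0 x.1
      rw [add_zero] at h
      simpa using h
    rw [h, zero_smul, zero_smul, add_zero]

theorem tildeDII_smul (E : LMod k A) (r : A) (t : Ω.Jet1 (Ω.Jet1 E)) :
    Ω.tildeDII E (r • t) = Ω.dWedge E r (Ω.tildeDI E t) + r • Ω.tildeDII E t := by
  induction t using BTensor.induction with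
  | tmul x t =>
    induction t using BTensor.induction with
    | tmul y e =>
      induction x using Jet1A.induction with
      | tmul a b =>
        induction y using Jet1A.induction with
        | tmul c c' =>
          rw [← bt_smul_left, smul_jc, tildeDII_bt, tildeDII_bt, tildeDI_bt, dWedge_bt,
            ← bt_smul_left, ← bt_add_left]
          congr 1
          apply Form.ext
          change Ω.d (Ω.incl (r * a)) * (Ω.d (Ω.incl (b * c)) * Ω.incl c') =
            Ω.d (Ω.incl r) * (Ω.incl a * (Ω.d (Ω.incl (b * c)) * Ω.incl c')) +
              Ω.incl r * (Ω.d (Ω.incl a) * (Ω.d (Ω.incl (b * c)) * Ω.incl c'))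
          rw [map_mul Ω.incl r, d_incl_mul]; noncomm_ring
        | add s t hs ht =>
          simp only [bt_add_left, bt_add_right, smul_add, map_add, hs, ht]; abel
      | add s t hs ht => simp only [bt_add_left, smul_add, map_add, hs, ht]; abel
    | add s t hs ht => simp only [bt_add_right, smul_add, map_add, hs, ht]; abel
  | add s t hs ht => simp only [smul_add, map_add, hs, ht]; abel

/-- The left `A`-linear map `D̃_E = (D̃ᴵ_E, D̃ᴵᴵ_E) : J¹J¹E → (Ω¹ ⋉ Ω²)E`. -/
def tildeD (E : LMod k A) : Ω.Jet1 (Ω.Jet1 E) →ₗ[A] Ω.SemiForm E where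
  toFun t := (Ω.tildeDI E t, Ω.tildeDII E t)
  map_add' s t := by rw [map_add, map_add]; rfl
  map_smul' r t := by rw [map_smul, tildeDII_smul]; rfl

/-- The submodule of a left `A`-module, as a left `A`-module. -/
abbrev ofSubmodule (M : LMod k A) (S : Submodule A M) : LMod k A where
  carrier := S

/-- Two consecutive holonomic jet modules `lo = JⁿE`, `hi = J^{n+1}E`, and the map
`l : J^{n+1}E → J¹JⁿE`. -/
structure JetStage where
  /-- `JⁿE` -/
  lo : LMod k A
  /-- `J^{n+1}E` -/
  hi : LMod k A
  /-- `J^{n+1}E → J¹JⁿE` -/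
  l : hi →ₗ[A] Ω.Jet1 lo

/-- The recursive construction of the holonomic jets: `J⁰E = E`, `J¹E = J¹A ⊗_A E`, and
`J^{n+2}E ⊆ J¹J^{n+1}E` is the kernel of
`J¹J^{n+1}E → J¹J¹JⁿE → (Ω¹ ⋉ Ω²)JⁿE`, the composite of `J¹(l)` and `D̃`. -/
def jetStage (E : LMod k A) : ℕ → Ω.JetStage
  | 0 => { lo := E, hi := Ω.Jet1 E, l := LinearMap.id }
  | n + 1 =>
    { lo := (jetStage E n).hi
      hi := ofSubmodule (Ω.Jet1 (jetStage E n).hi)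
        (LinearMap.ker (Ω.tildeD (jetStage E n).lo ∘ₗ Ω.jet1Map (jetStage E n).l))
      l := Submodule.subtype _ }

/-- The holonomic `n`-jet module `JⁿE`. -/
def J (n : ℕ) (E : LMod k A) : LMod k A := (Ω.jetStage E n).lo

/-- The map `l^{1,n} : J^{n+1}E → J¹JⁿE`: the identity for `n = 0`, the kernel inclusion for
`n ≥ 1`. -/
def l (n : ℕ) (E : LMod k A) : Ω.J (n + 1) E →ₗ[A] Ω.Jet1 (Ω.J n E) := (Ω.jetStage E n).l

theorem J_zero (E : LMod k A) : Ω.J 0 E = E := rfl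

theorem J_one (E : LMod k A) : Ω.J 1 E = Ω.Jet1 E := rfl

theorem J_add_two (n : ℕ) (E : LMod k A) : Ω.J (n + 2) E =
    ofSubmodule (Ω.Jet1 (Ω.J (n + 1) E))
      (LinearMap.ker (Ω.tildeD (Ω.J n E) ∘ₗ Ω.jet1Map (Ω.l n E))) := rfl

/-- The sesquiholonomic `n`-jet module `J^{n}E`: it is `E` for `n = 0` and `J¹E` for `n = 1`, and
`J^{n+2}E ⊆ J¹J^{n+1}E` (with `J^{n+1}E` holonomic) is the kernel of
`J¹J^{n+1}E → J¹J¹JⁿE → Ω¹JⁿE`, the composite of `J¹(l)` and `D̃ᴵ`. -/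
def sJ : ℕ → LMod k A → LMod k A
  | 0, E => E
  | 1, E => Ω.Jet1 E
  | n + 2, E => ofSubmodule (Ω.Jet1 (Ω.J (n + 1) E))
      (LinearMap.ker (Ω.tildeDI (Ω.J n E) ∘ₗ Ω.jet1Map (Ω.l n E)))

/-- The map `l^{{n+1}}` from sesquiholonomic `(n+1)`-jets to `J¹JⁿE`: the identity for `n = 0`, the
kernel inclusion for `n ≥ 1`. -/
def sl : (n : ℕ) → (E : LMod k A) → Ω.sJ (n + 1) E →ₗ[A] Ω.Jet1 (Ω.J n E)
  | 0, _ => LinearMap.id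
  | _ + 1, _ => Submodule.subtype _

/-- The natural inclusion of holonomic into sesquiholonomic `n`-jets: the identity for `n = 0, 1`,
and the inclusion of submodules of `J¹J^{n-1}E` for `n ≥ 2`. -/
def t : (n : ℕ) → (E : LMod k A) → Ω.J n E →ₗ[A] Ω.sJ n E
  | 0, _ => LinearMap.id
  | 1, _ => LinearMap.id
  | n + 2, E => Submodule.inclusion
      (p := LinearMap.ker (Ω.tildeD (Ω.J n E) ∘ₗ Ω.jet1Map (Ω.l n E)))
      (p' := LinearMap.ker (Ω.tildeDI (Ω.J n E) ∘ₗ Ω.jet1Map (Ω.l n E)))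
      (fun _ hx => congrArg Prod.fst hx)

/-- The map from sesquiholonomic `(n+1)`-jets to `J¹` of the sesquiholonomic `n`-jets, the composite
of `l^{{n+1}}` and `J¹` of the inclusion of holonomic into sesquiholonomic `n`-jets. -/
def sl1 (n : ℕ) (E : LMod k A) : Ω.sJ (n + 1) E →ₗ[A] Ω.Jet1 (Ω.sJ n E) :=
  Ω.jet1Map (Ω.t n E) ∘ₗ Ω.sl n E

/-- The holonomic Spencer operator `S^{n+1,m}_E : Ωᵐ J^{n+1}E → Ω^{m+1} JⁿE`. -/
def spencer (n m : ℕ) (E : LMod k A) :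
    Ω.FormMod m (Ω.J (n + 1) E) →ₗ[k] Ω.FormMod (m + 1) (Ω.J n E) :=
  Ω.spencer1 m (Ω.J n E) ∘ₗ (Ω.formMap m (Ω.l n E)).restrictScalars k

/-- The sesquiholonomic Spencer operator `S^{{n+1,m}}_E`, from `m`-forms with values in the
sesquiholonomic `(n+1)`-jets to `(m+1)`-forms with values in the sesquiholonomic `n`-jets. -/
def sSpencer (n m : ℕ) (E : LMod k A) :
    Ω.FormMod m (Ω.sJ (n + 1) E) →ₗ[k] Ω.FormMod (m + 1) (Ω.sJ n E) :=
  Ω.spencer1 m (Ω.sJ n E) ∘ₗ (Ω.formMap m (Ω.sl1 n E)).restrictScalars k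

/-- The operator `S̄^{{n+1,m}}_E`, from `m`-forms with values in the sesquiholonomic `(n+1)`-jets
to `(m+1)`-forms with values in the holonomic `n`-jets. -/
def spencerBar (n m : ℕ) (E : LMod k A) :
    Ω.FormMod m (Ω.sJ (n + 1) E) →ₗ[k] Ω.FormMod (m + 1) (Ω.J n E) :=
  Ω.spencer1 m (Ω.J n E) ∘ₗ (Ω.formMap m (Ω.sl n E)).restrictScalars k

/-- The unit `1 ∈ Ω⁰ = A`. -/
def oneForm : Ω.Form 0 := ⟨1, by simpa using Ω.incl_mem 1⟩

/-- The map `E → Ω⁰ ⊗_A E`, `e ↦ 1 ⊗ e`. -/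
def zeroFormMap (E : LMod k A) : E →ₗ[A] Ω.FormMod 0 E where
  toFun e := bt Ω.oneForm e
  map_add' x y := bt_add_right _ x y
  map_smul' r x := by
    rw [← bt_balanced, RingHom.id_apply, ← bt_smul_left]
    congr 1
    exact Form.ext (by rw [Form.val_rsmul, Form.val_lsmul]; simp [oneForm, Form.val])

theorem zeroFormMap_bijective (E : LMod k A) : Function.Bijective (Ω.zeroFormMap E) := by
  let e : A ≃ₗ[k] Ω.Form 0 := LinearEquiv.ofBijective
    ({ toFun := fun a => ⟨Ω.incl a, Ω.incl_mem a⟩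
       map_add' := fun a b => Form.ext (map_add Ω.incl a b)
       map_smul' := fun c a => Form.ext (map_smul Ω.incl c a) } : A →ₗ[k] Ω.Form 0)
    ⟨fun a b h => Ω.incl_injective (congrArg Form.val h), fun x => by
      have h := x.val_mem
      rw [← Ω.range_incl] at h
      obtain ⟨a, ha⟩ := h
      exact ⟨a, Form.ext ha⟩⟩
  have he (a : A) : (e a).val = Ω.incl a := rfl
  let G : Ω.FormMod 0 E →ₗ[k] E := BTensor.lift
    (LinearMap.mk₂ k (fun ω x => e.symm ω • x)
      (fun ω ω' x => by rw [map_add, add_smul])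
      (fun c ω x => by rw [map_smul, smul_assoc])
      (fun ω x y => smul_add _ x y)
      (fun c ω x => smul_comm _ c x))
    (fun ω a x => by
      simp only [LinearMap.mk₂_apply]
      obtain ⟨b, rfl⟩ := e.surjective ω
      have h : MulOpposite.op a • e b = e (b * a) := Form.ext (by
        rw [Form.val_rsmul, he, he, map_mul])
      rw [h, e.symm_apply_apply, e.symm_apply_apply, mul_smul])
  have h1 : Ω.oneForm = e 1 := Form.ext (by rw [he, map_one]; rfl)
  constructor
  · intro x y hxy
    have hG (z : E) : G (Ω.zeroFormMap E z) = z := by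
      change e.symm Ω.oneForm • z = z
      rw [h1, e.symm_apply_apply, one_smul]
    rw [← hG x, ← hG y, hxy]
  · intro x
    induction x using BTensor.induction with
    | tmul ω z =>
      obtain ⟨b, rfl⟩ := e.surjective ω
      refine ⟨b • z, ?_⟩
      change bt Ω.oneForm (b • z) = bt (e b) z
      rw [← bt_balanced]
      congr 1
      exact Form.ext (by rw [Form.val_rsmul, he]; simp [oneForm, Form.val])
    | add x y hx hy =>
      obtain ⟨x', rfl⟩ := hx
      obtain ⟨y', rfl⟩ := hy
      exact ⟨x' + y', map_add _ _ _⟩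

/-- The canonical identification `E ≅ Ω⁰ ⊗_A E`, `e ↦ 1 ⊗ e`. -/
noncomputable def zeroForm (E : LMod k A) : E ≃ₗ[A] Ω.FormMod 0 E :=
  LinearEquiv.ofBijective (Ω.zeroFormMap E) (Ω.zeroFormMap_bijective E)

/-- The operator `S̄^{{n+1,0}}_E`, on the sesquiholonomic `(n+1)`-jets, with `Ω⁰ ⊗_A -` removed. -/
noncomputable def spencerBar0 (n : ℕ) (E : LMod k A) :
    Ω.sJ (n + 1) E →ₗ[k] Ω.FormMod 1 (Ω.J n E) :=
  Ω.spencerBar n 0 E ∘ₗ (Ω.zeroForm (Ω.sJ (n + 1) E)).toLinearMap.restrictScalars k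

/-- The operator `S^{{n+1,0}}_E`, on the sesquiholonomic `(n+1)`-jets, with `Ω⁰ ⊗_A -` removed. -/
noncomputable def sSpencer0 (n : ℕ) (E : LMod k A) :
    Ω.sJ (n + 1) E →ₗ[k] Ω.FormMod 1 (Ω.sJ n E) :=
  Ω.sSpencer n 0 E ∘ₗ (Ω.zeroForm (Ω.sJ (n + 1) E)).toLinearMap.restrictScalars k

end ExteriorCalculus

end NCJet

/-!
On generators, `S^{1,0}` sends `[a ⊗ b] ⊗ ξ` to `da ⊗ b ξ`, and `S^{1,1}` then sends
`da ⊗ b [c ⊗ c'] ⊗ e` to `d(da · b c) c' ⊗ e = -da ∧ d(b c) c' ⊗ e`; hence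
`S^{1,1}_E ∘ S^{1,0}_{J¹E} = -D̃ᴵᴵ_E`. The Spencer operator being natural in the module, this
becomes the first assertion. A sesquiholonomic jet already satisfies the equation `D̃ᴵ = 0`, so the
kernel of `D̃ᴵᴵ` consists of the holonomic jets. Again by naturality, the composite of the
sesquiholonomic Spencer operators is the composite above followed by `Ω²` of the inclusion of
holonomic into sesquiholonomic jets, and this last map is injective when `Ω²` is flat.
-/

namespace NCJet

section BalancedTensor

variable {k : Type v} {A : Type u} [CommRing k] [Ring A] [Algebra k A]
variable {M : Type u} [AddCommGroup M] [Module k M] [Module A M] [IsScalarTower k A M]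
  [Module Aᵐᵒᵖ M] [SMulCommClass A Aᵐᵒᵖ M]

theorem bt_neg_left {N : Type u} [AddCommGroup N] [Module k N] [Module A N] (m : M) (n : N) :
    (bt (-m) n : BTensor k A M N) = -bt m n := by
  simpa only [neg_smul, one_smul] using bt_ksmul_left (A := A) (-1 : k) m n

theorem BTensor.mapRight_comp_apply {N N' N'' : Type u}
    [AddCommGroup N] [Module k N] [Module A N] [IsScalarTower k A N]
    [AddCommGroup N'] [Module k N'] [Module A N'] [IsScalarTower k A N']
    [AddCommGroup N''] [Module k N''] [Module A N''] [IsScalarTower k A N'']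
    (g : N' →ₗ[A] N'') (f : N →ₗ[A] N') (x : BTensor k A M N) :
    mapRight M (g ∘ₗ f) x = mapRight M g (mapRight M f x) := by
  induction x using BTensor.induction with
  | tmul m n => rfl
  | add x y hx hy => rw [map_add, map_add, hx, hy, map_add]

end BalancedTensor

namespace ExteriorCalculus

variable {k : Type v} {A : Type u} [CommRing k] [Ring A] [Algebra k A] (Ω : ExteriorCalculus k A)

theorem wedge_op_smul (p q : ℕ) (a : A) (x : Ω.Form p) (y : Ω.Form q) :
    Ω.wedge p q x (MulOpposite.op a • y) = MulOpposite.op a • Ω.wedge p q x y :=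
  Form.ext (mul_assoc x.val y.val (Ω.incl a)).symm

theorem dForm_op_smul (m : ℕ) (a : A) (ω : Ω.Form m) :
    Ω.dForm m (MulOpposite.op a • ω) =
      MulOpposite.op a • Ω.dForm m ω + (-1 : k) ^ m • Ω.wedge m 1 ω (Ω.dA a) := by
  apply Form.ext
  rw [val_dForm, Form.val_rsmul, Ω.d_mul m _ _ ω.val_mem, Form.val_add, Form.val_rsmul, val_dForm,
    Form.val_smul, val_wedge, val_dA, Algebra.smul_def, map_pow, map_neg, map_one]

theorem dForm_dA (a : A) : Ω.dForm 1 (Ω.dA a) = 0 :=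
  Form.ext (Ω.d_d (Ω.incl a))

theorem dForm_op_smul_dA (a b : A) :
    Ω.dForm 1 (MulOpposite.op b • Ω.dA a) = -Ω.wedge 1 1 (Ω.dA a) (Ω.dA b) := by
  rw [dForm_op_smul, dForm_dA, smul_zero, zero_add, pow_one, neg_smul, one_smul]

variable {Ω} in
@[elab_as_elim]
theorem jet1_induction {E : LMod k A} {p : Ω.Jet1 E → Prop} (x : Ω.Jet1 E)
    (tmul : ∀ a b e, p (bt (Ω.jc a b) e)) (add : ∀ x y, p x → p y → p (x + y)) : p x := by
  induction x using BTensor.induction with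
  | tmul j e =>
    induction j using Jet1A.induction with
    | tmul a b => exact tmul a b e
    | add s t hs ht => rw [bt_add_left]; exact add _ _ hs ht
  | add x y hx hy => exact add x y hx hy

theorem spencer1_formMap_jet1Map (m : ℕ) {E E' : LMod k A} (f : E →ₗ[A] E')
    (x : Ω.FormMod m (Ω.Jet1 E)) :
    Ω.spencer1 m E' (Ω.formMap m (Ω.jet1Map f) x) = Ω.formMap (m + 1) f (Ω.spencer1 m E x) := by
  induction x using BTensor.induction with
  | tmul ω y =>
    induction y using BTensor.induction with
    | tmul j e => rfl
    | add s t hs ht => simp only [bt_add_right, map_add, hs, ht]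
  | add s t hs ht => simp only [map_add, hs, ht]

/-- The first order Spencer operator `S^{1,0}_E : J¹E → Ω¹E`, with `Ω⁰ ⊗_A -` removed; both
`spencerBar0` and `sSpencer0` are composites of it with maps into `J¹`, namely `sl` and `sl1`. -/
noncomputable def spencer10 (E : LMod k A) : Ω.Jet1 E →ₗ[k] Ω.FormMod 1 E :=
  Ω.spencer1 0 E ∘ₗ (Ω.zeroForm (Ω.Jet1 E)).toLinearMap.restrictScalars k

theorem spencer10_bt (E : LMod k A) (a b : A) (e : E) :
    Ω.spencer10 E (bt (Ω.jc a b) e) = bt (Ω.dA a) (b • e) := by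
  have op_smul_oneForm : MulOpposite.op a • Ω.oneForm = (⟨Ω.incl a, Ω.incl_mem a⟩ : Ω.Form 0) :=
    Form.ext (one_mul (Ω.incl a))
  calc Ω.spencer10 E (bt (Ω.jc a b) e)
      = bt (MulOpposite.op b • Ω.dForm 0 (MulOpposite.op a • Ω.oneForm)) e := rfl
    _ = bt (MulOpposite.op b • Ω.dA a) e := by rw [op_smul_oneForm]; rfl
    _ = bt (Ω.dA a) (b • e) := bt_balanced _ _ _

theorem spencer10_jet1Map {E E' : LMod k A} (f : E →ₗ[A] E') (x : Ω.Jet1 E) :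
    Ω.spencer10 E' (Ω.jet1Map f x) = Ω.formMap 1 f (Ω.spencer10 E x) :=
  Ω.spencer1_formMap_jet1Map 0 f (Ω.zeroForm (Ω.Jet1 E) x)

theorem spencer1_spencer10 (E : LMod k A) (x : Ω.Jet1 (Ω.Jet1 E)) :
    Ω.spencer1 1 E (Ω.spencer10 (Ω.Jet1 E) x) = -Ω.tildeDII E x := by
  induction x using jet1_induction with
  | tmul a b ξ =>
    induction ξ using jet1_induction with
    | tmul c c' e =>
      calc Ω.spencer1 1 E (Ω.spencer10 (Ω.Jet1 E) (bt (Ω.jc a b) (bt (Ω.jc c c') e)))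
          = Ω.spencer1 1 E (bt (Ω.dA a) (bt (Ω.jc (b * c) c') e)) := by
            rw [spencer10_bt, ← bt_smul_left, smul_jc]
        _ = bt (MulOpposite.op c' • Ω.dForm 1 (MulOpposite.op (b * c) • Ω.dA a)) e :=
            Ω.spencer1_bt 1 E _ _ _ e
        _ = -bt (Ω.wedge 1 1 (Ω.dA a) (MulOpposite.op c' • Ω.dA (b * c))) e := by
            rw [dForm_op_smul_dA, smul_neg, bt_neg_left, wedge_op_smul]
    | add s t hs ht => simp only [bt_add_right, map_add, hs, ht, neg_add]
  | add s t hs ht => simp only [map_add, hs, ht, neg_add]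

theorem spencer_comp_spencerBar0 (n : ℕ) (E : LMod k A) :
    Ω.spencer n 1 E ∘ₗ Ω.spencerBar0 (n + 1) E =
      -(Ω.tildeDII (Ω.J n E) ∘ₗ (Ω.jet1Map (Ω.l n E)).restrictScalars k ∘ₗ
        (Ω.sl (n + 1) E).restrictScalars k) := by
  refine LinearMap.ext fun x => ?_
  let y := Ω.sl (n + 1) E x
  calc Ω.spencer n 1 E (Ω.spencerBar0 (n + 1) E x)
      = Ω.spencer1 1 (Ω.J n E) (Ω.formMap 1 (Ω.l n E) (Ω.spencer10 (Ω.J (n + 1) E) y)) := rfl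
    _ = Ω.spencer1 1 (Ω.J n E) (Ω.spencer10 (Ω.Jet1 (Ω.J n E)) (Ω.jet1Map (Ω.l n E) y)) := by
        rw [spencer10_jet1Map]
    _ = -Ω.tildeDII (Ω.J n E) (Ω.jet1Map (Ω.l n E) y) := Ω.spencer1_spencer10 _ _

theorem range_t_add_two (n : ℕ) (E : LMod k A) :
    (LinearMap.range (Ω.t (n + 2) E)).restrictScalars k =
      LinearMap.ker (Ω.tildeDII (Ω.J n E) ∘ₗ (Ω.jet1Map (Ω.l n E)).restrictScalars k ∘ₗ
        (Ω.sl (n + 1) E).restrictScalars k) := by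
  refine le_antisymm ?_ fun x hDII => ?_
  · rintro _ ⟨y, rfl⟩
    exact congrArg Prod.snd y.2
  · exact ⟨⟨x.1, Prod.ext x.2 hDII⟩, rfl⟩

theorem ker_spencer_comp_spencerBar0 (n : ℕ) (E : LMod k A) :
    LinearMap.ker (Ω.spencer n 1 E ∘ₗ Ω.spencerBar0 (n + 1) E) =
      (LinearMap.range (Ω.t (n + 2) E)).restrictScalars k := by
  rw [spencer_comp_spencerBar0, LinearMap.ker_neg, range_t_add_two]

theorem t_injective (n : ℕ) (E : LMod k A) : Function.Injective (Ω.t n E) := by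
  match n with
  | 0 => exact Function.injective_id
  | 1 => exact Function.injective_id
  | n + 2 => exact Submodule.inclusion_injective fun _ hx => congrArg Prod.fst hx

theorem sl_comp_t (n : ℕ) (E : LMod k A) : Ω.sl n E ∘ₗ Ω.t (n + 1) E = Ω.l n E := by
  cases n <;> rfl

theorem spencerBar_formMap_t (n m : ℕ) (E : LMod k A) (x : Ω.FormMod m (Ω.J (n + 1) E)) :
    Ω.spencerBar n m E (Ω.formMap m (Ω.t (n + 1) E) x) = Ω.spencer n m E x := by
  calc Ω.spencerBar n m E (Ω.formMap m (Ω.t (n + 1) E) x)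
      = Ω.spencer1 m (Ω.J n E) (Ω.formMap m (Ω.sl n E ∘ₗ Ω.t (n + 1) E) x) :=
        congrArg (Ω.spencer1 m (Ω.J n E)) (BTensor.mapRight_comp_apply _ _ x).symm
    _ = Ω.spencer n m E x := by rw [sl_comp_t]; rfl

theorem sSpencer_apply (n m : ℕ) (E : LMod k A) (x : Ω.FormMod m (Ω.sJ (n + 1) E)) :
    Ω.sSpencer n m E x = Ω.formMap (m + 1) (Ω.t n E) (Ω.spencerBar n m E x) := by
  calc Ω.sSpencer n m E x
      = Ω.spencer1 m (Ω.sJ n E) (Ω.formMap m (Ω.jet1Map (Ω.t n E)) (Ω.formMap m (Ω.sl n E) x)) :=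
        congrArg (Ω.spencer1 m (Ω.sJ n E)) (BTensor.mapRight_comp_apply _ _ x)
    _ = Ω.formMap (m + 1) (Ω.t n E) (Ω.spencerBar n m E x) :=
        Ω.spencer1_formMap_jet1Map m _ _

theorem sSpencer0_apply (n : ℕ) (E : LMod k A) (x : Ω.sJ (n + 1) E) :
    Ω.sSpencer0 n E x = Ω.formMap 1 (Ω.t n E) (Ω.spencerBar0 n E x) :=
  Ω.sSpencer_apply n 0 E (Ω.zeroForm (Ω.sJ (n + 1) E) x)

theorem sSpencer_comp_sSpencer0 (n : ℕ) (E : LMod k A) :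
    Ω.sSpencer n 1 E ∘ₗ Ω.sSpencer0 (n + 1) E =
      (Ω.formMap 2 (Ω.t n E)).restrictScalars k ∘ₗ Ω.spencer n 1 E ∘ₗ Ω.spencerBar0 (n + 1) E := by
  refine LinearMap.ext fun x => ?_
  calc Ω.sSpencer n 1 E (Ω.sSpencer0 (n + 1) E x)
      = Ω.sSpencer n 1 E (Ω.formMap 1 (Ω.t (n + 1) E) (Ω.spencerBar0 (n + 1) E x)) := by
        rw [sSpencer0_apply]
    _ = Ω.formMap 2 (Ω.t n E) (Ω.spencer n 1 E (Ω.spencerBar0 (n + 1) E x)) := by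
        rw [sSpencer_apply, spencerBar_formMap_t]

end ExteriorCalculus

end NCJet

theorem lemma3p21 {k : Type v} {A : Type u} [CommRing k] [Ring A] [Algebra k A]
    (Ω : NCJet.ExteriorCalculus k A) (E : NCJet.LMod k A) (n : ℕ) :
    (Ω.spencer n 1 E ∘ₗ Ω.spencerBar0 (n + 1) E =
      -(Ω.tildeDII (Ω.J n E) ∘ₗ (Ω.jet1Map (Ω.l n E)).restrictScalars k ∘ₗ
        (Ω.sl (n + 1) E).restrictScalars k)) ∧
    LinearMap.ker (Ω.spencer n 1 E ∘ₗ Ω.spencerBar0 (n + 1) E) =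
      (LinearMap.range (Ω.t (n + 2) E)).restrictScalars k ∧
    (LinearMap.range (Ω.t (n + 2) E)).restrictScalars k ≤
      LinearMap.ker (Ω.sSpencer n 1 E ∘ₗ Ω.sSpencer0 (n + 1) E) ∧
    (NCJet.IsRightFlat k A (Ω.Form 2) →
      LinearMap.ker (Ω.sSpencer n 1 E ∘ₗ Ω.sSpencer0 (n + 1) E) =
        (LinearMap.range (Ω.t (n + 2) E)).restrictScalars k) := by
  refine ⟨Ω.spencer_comp_spencerBar0 n E, Ω.ker_spencer_comp_spencerBar0 n E, ?_, fun hflat => ?_⟩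
  · rw [Ω.sSpencer_comp_sSpencer0, ← Ω.ker_spencer_comp_spencerBar0]
    exact LinearMap.ker_le_ker_comp _ _
  · have formMap_t_injective : Function.Injective (Ω.formMap 2 (Ω.t n E)) :=
      hflat _ _ _ (Ω.t_injective n E)
    rw [Ω.sSpencer_comp_sSpencer0, ← Ω.ker_spencer_comp_spencerBar0]
    exact LinearMap.ker_comp_of_ker_eq_bot _ (LinearMap.ker_eq_bot.2 formMap_t_injective)
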